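/- Fix $\alpha\in(0,1)$ and let $\tilde\Lambda(dx)=\alpha x^{-\alpha-1}\,dx$ on $(0,1)$. A point measure on $(0,1)$ is a countable sum of unit point masses that is finite on compact subsets of $(0,1)$; let $\mathbb M$ be the space of point measures on $(0,1)$ with the $\sigma$-algebra generated by the evaluations $M\mapsto M(A)$, $A$ Borel, and for $M\in\mathbb M$ let $T(M)=\int_{(0,1)}x\,M(dx)$ be the sum of its points. For $r\in\mathbb N=\{1,2,\dots\}$, a random point measure $\mathbb B^{(r)}$ on $(0,1)$ is a negative binomial point process, $\mathbb B^{(r)}\sim\mathcal{BN}(r,\tilde\Lambda)$, if $$E\Big(e^{-\int f\,d\mathbb B^{(r)}}\Big)=\Big(1+\int_{(0,1)}(1-e^{-f(x)})\,\tilde\Lambda(dx)\Big)^{-r}$$ for every measurable $f:(0,1)\to[0,\infty)$. Let $r\in\mathbb N$, $\mathbb B^{(r)}\sim\mathcal{BN}(r,\tilde\Lambda)$ and $\mathbb B^{(r+1)}\sim\mathcal{BN}(r+1,\tilde\Lambda)$. Let $\tilde J_1$ be the first size-biased pick from $\mathbb B^{(r)}$, that is, a random variable in $(0,1)$ whose conditional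 law given $\mathbb B^{(r)}$ is $\frac{x}{T(\mathbb B^{(r)})}\,\mathbb B^{(r)}(dx)$. Let $\mathbb B^{(r)}_1=\mathbb B^{(r)}-\delta_{\tilde J_1}$ be the process left after removing it, ${}^{(r)}T_1=T(\mathbb B^{(r)})-\tilde J_1$ the remaining sum, and ${}^{(r+1)}T=T(\mathbb B^{(r+1)})$. Then ${}^{(r)}T_1\in(0,\infty)$ almost surely, and the following equalities of measures hold. (i) On $(0,1)\times\mathbb M$, $$P\big(\tilde J_1\in dx,\ \mathbb B^{(r)}_1\in dM\big)=\frac{x}{T(M)+x}\;r\tilde\Lambda(dx)\;P\big(\mathbb B^{(r+1)}\in dM\big).$$ (ii) On $(0,1)\times\mathbb M\times(0,\infty)$, $$P\big(\tilde J_1\in dx,\ \mathbb B^{(r)}_1\in dM,\ {}^{(r)}T_1\in dt\big)=\frac{x}{t+x}\;r\tilde\Lambda(dx)\;P\big(\mathbb B^{(r+1)}\in dM,\ T(\mathbb B^{(r+1)})\in dt\big).$$ (iii) On $(0,1)\times(0,\infty)$, $$P\big(\tilde J_1\in dx,\ {}^{(r)}T_1\in dt\big)=\frac{x}{t+x}\;r\tilde\Lambda(dx)\;P\big({}^{(r+1)}T\in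 dt\big).$$ -/

import Mathlib

open MeasureTheory ProbabilityTheory
open scoped ENNReal NNReal

noncomputable section

/-- A point measure on `E`: a countable sum of unit point masses (repetitions allowed)
that is finite on compact sets. -/
def IsPointMeasure {E : Type*} [TopologicalSpace E] [MeasurableSpace E] (M : Measure E) : Prop :=
  (∃ (ι : Type) (_ : Countable ι) (p : ι → E), M = Measure.sum fun i => Measure.dirac (p i)) ∧
    ∀ K : Set E, IsCompact K → M K < ∞

/-- `e^{-a}` for `a ∈ [0,∞]`, with `e^{-∞} = 0`. -/
def expNeg (a : ℝ≥0∞) : ℝ≥0∞ := EReal.exp (-(a : EReal))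

/-- The Laplace functional `Φ(f) = E (exp (-∫ f dξ))` of a random measure `ξ`. -/
def laplaceFunctional {Ω E : Type*} [MeasurableSpace Ω] [MeasurableSpace E]
    (P : Measure Ω) (ξ : Ω → Measure E) (f : E → ℝ≥0) : ℝ≥0∞ :=
  ∫⁻ ω, expNeg (∫⁻ x, (f x : ℝ≥0∞) ∂(ξ ω)) ∂P

/-- `ξ` is a negative binomial point process `BN(r, Π)` under `P`: a random point measure with
Laplace functional `Φ(f) = (1 + ∫ (1 - e^{-f(x)}) Π(dx))^{-r}` for all nonnegative measurable `f`.
The σ-algebra on `Measure E` is the one generated by the evaluations `M ↦ M A`. -/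
structure IsNegBinomialProcess {Ω E : Type*} [MeasurableSpace Ω] [TopologicalSpace E]
    [MeasurableSpace E] (P : Measure Ω) (ξ : Ω → Measure E) (r : ℕ) (Pi : Measure E) : Prop where
  measurable : Measurable ξ
  isPointMeasure : ∀ᵐ ω ∂P, IsPointMeasure (ξ ω)
  laplace : ∀ f : E → ℝ≥0, Measurable f →
    laplaceFunctional P ξ f = ((1 + ∫⁻ x, (1 - expNeg (f x)) ∂Pi) ^ r)⁻¹

/-- The open unit interval `(0,1)` as a space. -/
abbrev UnitIoo : Type := Set.Ioo (0 : ℝ) 1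

/-- The size of a point of `(0,1)`, as an element of `[0,∞]`. -/
def UnitIoo.size (x : UnitIoo) : ℝ≥0∞ := ENNReal.ofReal (x : ℝ)

/-- The measure `α x^{-α-1} dx` on `(0,1)`. -/
def stableLevy (α : ℝ) : Measure UnitIoo :=
  (Measure.comap ((↑) : UnitIoo → ℝ) volume).withDensity fun x =>
    ENNReal.ofReal (α * (x : ℝ) ^ (-α - 1))

/-- `T(M)`, the sum of the points of the point measure `M` (with multiplicity). -/
def pointSum (M : Measure UnitIoo) : ℝ≥0∞ := ∫⁻ x, x.size ∂M

/-- `J` is a size-biased pick from the points of the random point measure `B`: conditionally on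
`B`, it is distributed according to `x / T(B) · B(dx)`, that is, it equals a given point of `B`
with probability the size of that point divided by the sum of all the points. -/
structure IsSizeBiasedPick {Ω : Type*} [MeasurableSpace Ω] (P : Measure Ω)
    (B : Ω → Measure UnitIoo) (J : Ω → UnitIoo) : Prop where
  measurable : Measurable J
  condProb : ∀ A : Set UnitIoo, MeasurableSet A →
    P⟦J ⁻¹' A | MeasurableSpace.comap B inferInstance⟧ =ᵐ[P]
      fun ω => ((∫⁻ x in A, x.size / pointSum (B ω) ∂(B ω))).toReal

end

/-! ### The exponential `expNeg` on `[0,∞]` and its dyadic difference quotients. -/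

section ExpNeg

/-! Write ψ(f) = ∫ (1 - e^{-f}) dΠ. Taking minus the derivative in t at 0 of the Laplace functional
(1 + ψ(f + t g))^{-r} gives E[e^{-∫ f dB} ∫ g dB] = r ∫ e^{-f} g dΠ · (1 + ψ(f))^{-(r+1)}
(`IsNegBinomialProcess.lintegral_expNeg_mul_lintegral`). The last factor is the Laplace functional
of BN(r + 1, Π), and e^{-f(x)} is the contribution of one extra point at x. Laplace functionals
determine laws (`Measure.ext_of_laplace`), so this is the Palm formula
`IsNegBinomialProcess.campbell_eq`: under the Campbell measure of B, the marked point has intensity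
rΠ and the other points form an independent BN(r + 1, Π).

A size-biased pick reweights the Campbell measure by x / T(M), and this becomes x / (T(M) + x) once
M is replaced by M + δ_x (`IsNegBinomialProcess.lintegral_sizeBiasedPick`). Removing the pick undoes
the addition of δ_x. The weight depends only on x and T(M), so (i), (ii) and (iii) are images of one
identity (`IsNegBinomialProcess.map_removal`).

T(B) is finite because a size-biased pick exists; the remaining sum is positive because Π has
infinite mass. `pointKernel` and `removePoint` supply the joint measurability needed to treat M and
M - δ_x as functions of (M, x). -/

lemma expNeg_zero : expNeg 0 = 1 := by simp [expNeg]

lemma expNeg_top : expNeg ∞ = 0 := by simp [expNeg]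

lemma expNeg_coe (a : ℝ≥0) : expNeg a = ENNReal.ofReal (Real.exp (-a)) := by
  have : (-((a : ℝ≥0∞) : EReal)) = ((-(a : ℝ) : ℝ) : EReal) := rfl
  rw [expNeg, this, EReal.exp_coe]

lemma expNeg_add (a b : ℝ≥0∞) : expNeg (a + b) = expNeg a * expNeg b := by
  rw [expNeg, expNeg, expNeg, EReal.exp_neg, EReal.exp_neg, EReal.exp_neg, EReal.coe_ennreal_add,
    EReal.exp_add, ENNReal.mul_inv]
  · exact Or.inl (by simp)
  · exact Or.inr (by simp)

lemma expNeg_le_one (a : ℝ≥0∞) : expNeg a ≤ 1 := by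
  rw [expNeg, EReal.exp_le_one_iff, EReal.neg_le_zero]
  exact EReal.coe_ennreal_nonneg a

lemma expNeg_ne_top (a : ℝ≥0∞) : expNeg a ≠ ∞ :=
  ne_top_of_le_ne_top ENNReal.one_ne_top (expNeg_le_one a)

lemma continuous_expNeg : Continuous expNeg :=
  ENNReal.continuous_exp.comp (continuous_neg.comp continuous_coe_ennreal_ereal)

lemma measurable_expNeg : Measurable expNeg := continuous_expNeg.measurable

lemma expNeg_injective : Function.Injective expNeg := fun a b h => by
  have := EReal.exp_strictMono.injective h
  simpa using this

lemma measurableEmbedding_expNeg : MeasurableEmbedding expNeg :=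
  continuous_expNeg.measurableEmbedding expNeg_injective

lemma expNeg_nsmul (n : ℕ) (a : ℝ≥0∞) : expNeg (n * a) = expNeg a ^ n := by
  induction n with
  | zero => simp [expNeg_zero]
  | succ n ih => rw [Nat.cast_succ, add_mul, one_mul, expNeg_add, ih, pow_succ]

lemma expNeg_sum {ι : Type*} (s : Finset ι) (a : ι → ℝ≥0∞) :
    expNeg (∑ i ∈ s, a i) = ∏ i ∈ s, expNeg (a i) := by
  classical
  induction s using Finset.induction_on with
  | empty => simp [expNeg_zero]
  | insert i s hi ih => rw [Finset.sum_insert hi, Finset.prod_insert hi, expNeg_add, ih]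

lemma one_sub_sq_le {q : ℝ≥0∞} (hq : q ≤ 1) : 1 - q * q ≤ 2 * (1 - q) := by
  lift q to ℝ≥0 using ne_top_of_le_ne_top ENNReal.one_ne_top hq
  have hq : q ≤ 1 := by exact_mod_cast hq
  have hq2 : q * q ≤ 1 := mul_le_one' hq hq
  norm_cast
  rw [← NNReal.coe_le_coe, NNReal.coe_sub hq2]
  push_cast [NNReal.coe_sub hq]
  nlinarith [sq_nonneg (1 - (q : ℝ))]

/-- Concavity of t ↦ 1 - e^{-ta}, in the form 1 - q² ≤ 2(1 - q) with q = e^{-ta/2}; halving t makes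
this one inequality suffice. Monotonicity allows derivatives to be taken under integrals by monotone
convergence, without a moment assumption on the random measure. -/
lemma monotone_dyadic_expNeg (a : ℝ≥0∞) :
    Monotone fun n : ℕ => 2 ^ n * (1 - expNeg (((2⁻¹ : ℝ≥0) ^ n : ℝ≥0) * a)) := by
  refine monotone_nat_of_le_succ fun n => ?_
  have h : ((((2⁻¹ : ℝ≥0) ^ n : ℝ≥0) : ℝ≥0∞) * a) =
      ((2⁻¹ : ℝ≥0) ^ (n + 1) : ℝ≥0) * a + ((2⁻¹ : ℝ≥0) ^ (n + 1) : ℝ≥0) * a := by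
    rw [← add_mul, ← ENNReal.coe_add]
    congr 2
    rw [pow_succ, ← mul_add, ← two_mul, mul_inv_cancel₀ two_ne_zero, mul_one]
  rw [h, expNeg_add, pow_succ (2 : ℝ≥0∞), mul_assoc]
  gcongr
  exact one_sub_sq_le (expNeg_le_one _)

lemma tendsto_dyadic_expNeg (a : ℝ≥0∞) :
    Filter.Tendsto (fun n : ℕ => 2 ^ n * (1 - expNeg (((2⁻¹ : ℝ≥0) ^ n : ℝ≥0) * a)))
      Filter.atTop (nhds a) := by
  induction a with
  | top =>
    have h : ∀ n : ℕ, (((2⁻¹ : ℝ≥0) ^ n : ℝ≥0) : ℝ≥0∞) * ∞ = ∞ := fun n =>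
      ENNReal.mul_top (by positivity)
    simp only [h, expNeg_top, tsub_zero, mul_one]
    exact ENNReal.tendsto_pow_atTop_nhds_top_iff.2 (by norm_num)
  | coe a =>
    have hd : HasFDerivWithinAt (fun x : ℝ => -Real.exp (-(x * a)))
        (ContinuousLinearMap.toSpanSingleton ℝ (a : ℝ)) Set.univ 0 := by
      have : HasDerivAt (fun x : ℝ => -Real.exp (-(x * a))) (a : ℝ) 0 := by
        have := (((hasDerivAt_id (0 : ℝ)).mul_const (a : ℝ)).neg.exp).neg
        simp only [id, one_mul, Pi.neg_def] at this
        simpa using this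
      exact this.hasFDerivAt.hasFDerivWithinAt
    have hl := hd.lim (l := Filter.atTop) (c := fun n : ℕ => (2 : ℝ) ^ n)
      (d := fun n : ℕ => (2⁻¹ : ℝ) ^ n) (v := 1)
      (tendsto_pow_atTop_nhds_zero_of_lt_one (by norm_num) (by norm_num)) (by simp)
      (by simp)
    simp only [zero_add, zero_mul, neg_zero, Real.exp_zero, smul_eq_mul,
      ContinuousLinearMap.toSpanSingleton_apply, one_mul] at hl
    have hl' := ENNReal.tendsto_ofReal hl
    rw [ENNReal.ofReal_coe_nnreal] at hl'
    refine hl'.congr fun n => ?_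
    rw [← ENNReal.coe_mul, expNeg_coe, ENNReal.ofReal_mul (by positivity), ← ENNReal.ofReal_one,
      ← ENNReal.ofReal_sub _ (Real.exp_pos _).le, ENNReal.ofReal_pow (by norm_num)]
    simp only [ENNReal.ofReal_ofNat]
    congr 2
    push_cast
    ring

end ExpNeg

/-! ### Laplace functionals determine the laws of random measures. -/

section Uniqueness

/-- Finite measures on a finite-dimensional cube are determined by their moments. -/
lemma Measure.ext_of_moments_unitInterval {ι : Type*} [Fintype ι]
    {μ ν : Measure (ι → unitInterval)} [IsFiniteMeasure μ] [IsFiniteMeasure ν]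
    (h : ∀ k : ι → ℕ, ∫ x, ∏ i, (x i : ℝ) ^ k i ∂μ = ∫ x, ∏ i, (x i : ℝ) ^ k i ∂ν) : μ = ν := by
  classical
  let coord : ι → BoundedContinuousFunction (ι → unitInterval) ℝ := fun i =>
    BoundedContinuousFunction.mkOfCompact ⟨fun x => (x i : ℝ), by fun_prop⟩
  -- Polynomials in the coordinates: they separate points, hence determine finite measures, and
  -- their integrals are combinations of moments.
  let S : StarSubalgebra ℝ (BoundedContinuousFunction (ι → unitInterval) ℝ) :=
    { (MvPolynomial.aeval (R := ℝ) coord).range with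
      star_mem' := by
        intro a ha
        have : star a = a := by ext x; simp
        rwa [this] }
  refine ext_of_forall_mem_subalgebra_integral_eq_of_polish (A := S) ?_ ?_
  · intro x y hxy
    obtain ⟨i, hi⟩ := Function.ne_iff.1 hxy
    refine ⟨coord i, ⟨_, ⟨coord i, ⟨MvPolynomial.X i, by simp⟩, rfl⟩, rfl⟩, ?_⟩
    simpa [coord, Subtype.ext_iff] using hi
  · rintro g ⟨p, rfl⟩
    have hp : ∀ x, (MvPolynomial.aeval (R := ℝ) coord p) x =
        ∑ d ∈ p.support, p.coeff d * ∏ i, (x i : ℝ) ^ d i := by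
      intro x
      rw [MvPolynomial.aeval_def, MvPolynomial.eval₂_eq']
      simp [coord, BoundedContinuousFunction.coe_sum, Finset.sum_apply,
        BoundedContinuousFunction.coe_prod, Finset.prod_apply]
    have hi : ∀ (ρ : Measure (ι → unitInterval)) [IsFiniteMeasure ρ], ∀ d ∈ p.support,
        Integrable (fun x => p.coeff d * ∏ i, (x i : ℝ) ^ d i) ρ := by
      intro ρ _ d _
      exact (BoundedContinuousFunction.mkOfCompact
        (⟨fun x : ι → unitInterval => p.coeff d * ∏ i, (x i : ℝ) ^ d i,
          by fun_prop⟩ : C(_, ℝ))).integrable ρ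
    have key : ∀ (ρ : Measure (ι → unitInterval)) [IsFiniteMeasure ρ],
        ∫ x, (MvPolynomial.aeval (R := ℝ) coord p) x ∂ρ =
          ∑ d ∈ p.support, p.coeff d * ∫ x, ∏ i, (x i : ℝ) ^ d i ∂ρ := by
      intro ρ _
      simp_rw [hp]
      rw [integral_finsetSum _ (hi ρ)]
      simp_rw [integral_const_mul]
    exact (key μ).trans ((Finset.sum_congr rfl fun d _ => by rw [h d]).trans (key ν).symm)

/-- The family of all values `e^{-M A}`, `A` measurable. -/
noncomputable def expNegEval {E : Type*} [MeasurableSpace E] (M : Measure E)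
    (A : {A : Set E // MeasurableSet A}) : unitInterval :=
  ⟨(expNeg (M A)).toReal, ENNReal.toReal_nonneg, by
    simpa using ENNReal.toReal_mono ENNReal.one_ne_top (expNeg_le_one (M A))⟩

variable {E : Type*} [MeasurableSpace E]

lemma measurable_expNegEval : Measurable (expNegEval : Measure E → _) :=
  measurable_pi_lambda _ fun A =>
    ((measurable_expNeg.comp (Measure.measurable_coe A.2)).ennreal_toReal).subtype_mk

/-- Since `expNeg` is a measurable embedding of `[0,∞]`, no information in M A is lost by passing to
e^{-M A}, not even the value ∞. -/
lemma measurableSpace_measure_le_comap_expNegEval :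
    (Measure.instMeasurableSpace : MeasurableSpace (Measure E)) ≤
      MeasurableSpace.comap expNegEval MeasurableSpace.pi := by
  refine iSup₂_le fun A hA => ?_
  rw [← measurable_iff_comap_le]
  let _ : MeasurableSpace (Measure E) := MeasurableSpace.comap expNegEval MeasurableSpace.pi
  refine measurableEmbedding_expNeg.measurable_comp_iff.1 ?_
  have h1 : Measurable fun M : Measure E => ((expNegEval M ⟨A, hA⟩ : unitInterval) : ℝ) :=
    measurable_subtype_coe.comp ((measurable_pi_apply _).comp (comap_measurable expNegEval))
  convert h1.ennreal_ofReal using 2 with M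
  exact (ENNReal.ofReal_toReal (expNeg_ne_top _)).symm

/-- The law of a random measure is determined by its Laplace functional. -/
theorem Measure.ext_of_laplace {μ ν : Measure (Measure E)} [IsFiniteMeasure μ] [IsFiniteMeasure ν]
    (h : ∀ f : E → ℝ≥0, Measurable f →
      ∫⁻ M, expNeg (∫⁻ x, f x ∂M) ∂μ = ∫⁻ M, expNeg (∫⁻ x, f x ∂M) ∂ν) : μ = ν := by
  classical
  have hmap : μ.map expNegEval = ν.map expNegEval := by
    -- The index set of all measurable sets may be uncountable, so the comparison goes through
    -- finite-dimensional marginals.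
    refine IsProjectiveLimit.unique
      (P := fun I => (μ.map expNegEval).map I.restrict) (fun I => rfl) fun I => ?_
    symm
    refine Measure.ext_of_moments_unitInterval fun k => ?_
    have hm : Measurable fun M : Measure E => I.restrict (expNegEval M) :=
      (Finset.measurable_restrict I).comp measurable_expNegEval
    -- A mixed moment is a Laplace functional: ∏ (e^{-M A_i})^{k_i} = e^{-∫ f dM} with f = Σ k_i
    -- 1_{A_i}.
    have key : ∀ ρ : Measure (Measure E),
        ∫ x, ∏ i, (x i : ℝ) ^ k i ∂((ρ.map expNegEval).map I.restrict) =
        (∫⁻ M, expNeg (∫⁻ x, ((∑ i : I, (i : Set E).indicator (fun _ => (k i : ℝ≥0)) x : ℝ≥0)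
          : ℝ≥0∞) ∂M) ∂ρ).toReal := by
      intro ρ
      rw [Measure.map_map (Finset.measurable_restrict I) measurable_expNegEval,
        integral_map (φ := I.restrict ∘ expNegEval) hm.aemeasurable
          (Continuous.aestronglyMeasurable (by fun_prop)), ← integral_toReal]
      · refine integral_congr_ae (Filter.Eventually.of_forall fun M => ?_)
        simp only [ENNReal.ofNNReal_finsetSum, ENNReal.coe_indicator, ENNReal.coe_natCast]
        rw [lintegral_finsetSum]
        · simp only [lintegral_indicator_const (Subtype.prop _), expNeg_sum]
          rw [ENNReal.toReal_prod]
          refine Finset.prod_congr rfl fun i _ => ?_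
          rw [expNeg_nsmul, ENNReal.toReal_pow]
          rfl
        · intro i _
          exact measurable_const.indicator i.1.2
      · refine (measurable_expNeg.comp (Measure.measurable_lintegral ?_)).aemeasurable
        refine (Finset.measurable_sum _ fun i _ => ?_).coe_nnreal_ennreal
        exact measurable_const.indicator i.1.2
      · exact Filter.Eventually.of_forall fun M => (expNeg_ne_top _).lt_top
    rw [key, key, h]
    exact Finset.measurable_sum _ fun i _ => measurable_const.indicator i.1.2
  ext S hS
  obtain ⟨T, hT, rfl⟩ := measurableSpace_measure_le_comap_expNegEval S hS
  rw [← Measure.map_apply measurable_expNegEval hT, hmap,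
    Measure.map_apply measurable_expNegEval hT]

end Uniqueness

/-! ### Differentiating the Laplace functional. -/

section Palm

/-- The derivative of -x^{-r} at a, along increments d n ~ 2^{-n} D, with the subtraction taken in
`ℝ≥0∞`. -/
lemma tendsto_dyadic_inv_pow_sub (r : ℕ) {a D : ℝ≥0∞} (ha1 : 1 ≤ a) (ha : a ≠ ∞) (hD : D ≠ ∞)
    {d : ℕ → ℝ≥0∞} (hd : ∀ n, d n ≠ ∞)
    (hdD : Filter.Tendsto (fun n => 2 ^ n * d n) Filter.atTop (nhds D)) :
    Filter.Tendsto (fun n => 2 ^ n * ((a ^ r)⁻¹ - ((a + d n) ^ r)⁻¹)) Filter.atTop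
      (nhds (r * D * (a ^ (r + 1))⁻¹)) := by
  lift a to ℝ≥0 using ha
  lift D to ℝ≥0 using hD
  lift d to ℕ → ℝ≥0 using hd
  have ha1 : (1 : ℝ) ≤ a := by exact_mod_cast ha1
  have ha0 : (0 : ℝ) < a := by linarith
  have hdD' : Filter.Tendsto (fun n => (2 : ℝ) ^ n * d n) Filter.atTop (nhds (D : ℝ)) := by
    have := (ENNReal.tendsto_toReal ENNReal.coe_ne_top).comp hdD
    simpa [Function.comp_def] using this
  have hd0 : Filter.Tendsto (fun n => (d n : ℝ)) Filter.atTop (nhds 0) := by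
    have := (tendsto_pow_atTop_nhds_zero_of_lt_one (r := (2⁻¹ : ℝ)) (by norm_num)
      (by norm_num)).mul hdD'
    simpa [← mul_assoc, ← mul_pow] using this
  have hder : HasDerivAt (fun x : ℝ => -(x ^ r)⁻¹) (r * ((a : ℝ) ^ (r + 1))⁻¹) a := by
    have := ((hasDerivAt_pow r (a : ℝ)).fun_inv (by positivity)).fun_neg
    refine this.congr_deriv ?_
    rcases r with _ | r
    · simp
    · simp only [Nat.add_sub_cancel]
      field_simp
      ring
  have hl := hder.hasFDerivAt.hasFDerivWithinAt (s := Set.univ).lim (l := Filter.atTop)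
    (c := fun n : ℕ => (2 : ℝ) ^ n) (d := fun n => (d n : ℝ)) (v := D) hd0 (by simp)
    (by simpa using hdD')
  have hl' := ENNReal.tendsto_ofReal hl
  have hlim : ENNReal.ofReal ((ContinuousLinearMap.toSpanSingleton ℝ
      (r * ((a : ℝ) ^ (r + 1))⁻¹)) (D : ℝ)) = r * (D : ℝ≥0∞) * ((a : ℝ≥0∞) ^ (r + 1))⁻¹ := by
    simp only [ContinuousLinearMap.toSpanSingleton_apply, smul_eq_mul]
    rw [ENNReal.ofReal_mul (by positivity), ENNReal.ofReal_mul (by positivity),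
      ENNReal.ofReal_coe_nnreal, ENNReal.ofReal_natCast, ENNReal.ofReal_inv_of_pos (by positivity),
      ENNReal.ofReal_pow ha0.le, ENNReal.ofReal_coe_nnreal]
    ring
  rw [hlim] at hl'
  refine hl'.congr fun n => ?_
  have hadn : (0 : ℝ) < a + d n := by positivity
  rw [smul_eq_mul, neg_sub_neg, ENNReal.ofReal_mul (by positivity),
    ENNReal.ofReal_sub _ (by positivity), ENNReal.ofReal_inv_of_pos (by positivity),
    ENNReal.ofReal_inv_of_pos (by positivity), ENNReal.ofReal_pow ha0.le,
    ENNReal.ofReal_pow hadn.le, ENNReal.ofReal_pow (by norm_num), ENNReal.ofReal_add (by positivity)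
    (by positivity), ENNReal.ofReal_coe_nnreal, ENNReal.ofReal_coe_nnreal, ENNReal.ofReal_ofNat]

variable {Ω E : Type*} [MeasurableSpace Ω] [TopologicalSpace E] [MeasurableSpace E]
  {P : Measure Ω} {B : Ω → Measure E} {r : ℕ} {Pi : Measure E}

lemma one_sub_expNeg_add (a b : ℝ≥0∞) :
    1 - expNeg (a + b) = (1 - expNeg a) + expNeg a * (1 - expNeg b) := by
  rw [expNeg_add, ENNReal.mul_sub (fun _ _ => expNeg_ne_top a), mul_one]
  exact (tsub_add_tsub_cancel (expNeg_le_one a)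
    (mul_le_of_le_one_right' (expNeg_le_one b))).symm

/-- The Campbell measure of a negative binomial process, integrated against `g(x) e^{-∫ f dM}`. -/
theorem IsNegBinomialProcess.lintegral_expNeg_mul_lintegral [IsFiniteMeasure P]
    (hB : IsNegBinomialProcess P B r Pi) (hr : r ≠ 0)
    {f g : E → ℝ≥0} (hf : Measurable f) (hg : Measurable g) (hgi : ∫⁻ x, g x ∂Pi ≠ ∞) :
    ∫⁻ ω, expNeg (∫⁻ x, f x ∂(B ω)) * ∫⁻ x, g x ∂(B ω) ∂P =
      r * (∫⁻ x, expNeg (f x) * g x ∂Pi) * ((1 + ∫⁻ x, (1 - expNeg (f x)) ∂Pi) ^ (r + 1))⁻¹ := by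
  have hint : ∀ {h : E → ℝ≥0}, Measurable h → Measurable fun ω => ∫⁻ x, h x ∂(B ω) := fun hh =>
    (Measure.measurable_lintegral hh.coe_nnreal_ennreal).comp hB.measurable
  have hmf : Measurable fun x => expNeg (f x) := measurable_expNeg.comp hf.coe_nnreal_ennreal
  have hmB : Measurable fun ω => expNeg (∫⁻ x, f x ∂(B ω)) := measurable_expNeg.comp (hint hf)
  have hms : Measurable fun x => 1 - expNeg (f x) := measurable_const.sub hmf
  have hlf := hB.laplace f hf
  -- If ψ(f) = ∞, the Laplace functional vanishes because r ≠ 0. Then e^{-∫ f dB} = 0 almost surely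
  -- and both sides are 0.
  by_cases hψ : ∫⁻ x, (1 - expNeg (f x)) ∂Pi = ∞
  · have h0 : laplaceFunctional P B f = 0 := by
      rw [hlf, hψ]; simp [hr]
    rw [laplaceFunctional, lintegral_eq_zero_iff hmB] at h0
    rw [hψ]
    simp only [add_top, ENNReal.top_pow (Nat.succ_ne_zero r), ENNReal.inv_top, mul_zero]
    refine (lintegral_congr_ae ?_).trans lintegral_zero
    filter_upwards [h0] with ω hω
    simp only [_root_.Pi.zero_apply] at hω
    rw [hω, zero_mul]
  set t : ℕ → ℝ≥0 := fun n => 2⁻¹ ^ n with ht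
  -- d n is the increment ψ(f + t_n g) - ψ(f).
  set d : ℕ → ℝ≥0∞ := fun n => ∫⁻ x, expNeg (f x) * (1 - expNeg (t n * g x)) ∂Pi with hd
  have hmt : ∀ n, Measurable fun x => expNeg (f x) * (1 - expNeg (t n * g x)) := fun n =>
    hmf.mul (measurable_const.sub
      (measurable_expNeg.comp (hg.coe_nnreal_ennreal.const_mul _)))
  have hD : ∫⁻ x, expNeg (f x) * g x ∂Pi ≠ ∞ :=
    ne_top_of_le_ne_top hgi (lintegral_mono fun x => mul_le_of_le_one_left' (expNeg_le_one _))
  have hdD : Filter.Tendsto (fun n => 2 ^ n * d n) Filter.atTop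
      (nhds (∫⁻ x, expNeg (f x) * g x ∂Pi)) := by
    have : ∀ n, 2 ^ n * d n = ∫⁻ x, expNeg (f x) * (2 ^ n * (1 - expNeg (t n * g x))) ∂Pi := by
      intro n
      rw [hd, ← lintegral_const_mul _ (hmt n)]
      exact lintegral_congr fun x => by ring
    simp_rw [this]
    refine lintegral_tendsto_of_tendsto_of_monotone (fun n => ?_)
      (Filter.Eventually.of_forall fun x => ?_) (Filter.Eventually.of_forall fun x => ?_)
    · exact (hmf.mul ((measurable_const.sub (measurable_expNeg.comp
        (hg.coe_nnreal_ennreal.const_mul _))).const_mul _)).aemeasurable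
    · exact fun m n hmn => mul_le_mul_right (monotone_dyadic_expNeg (g x) hmn) _
    · exact ENNReal.Tendsto.const_mul (tendsto_dyadic_expNeg _) (Or.inr (expNeg_ne_top _))
  -- The sequence 2^n d n increases to a finite limit.
  have hdfin : ∀ n, d n ≠ ∞ := by
    intro n
    have hmono : Monotone fun n => 2 ^ n * d n := by
      intro m n hmn
      simp only [hd]
      rw [← lintegral_const_mul _ (hmt m), ← lintegral_const_mul _ (hmt n)]
      refine lintegral_mono fun x => ?_
      rw [mul_left_comm, mul_left_comm (2 ^ n)]
      exact mul_le_mul_right (monotone_dyadic_expNeg (g x) hmn) _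
    have h1 := ne_top_of_le_ne_top hD (hmono.ge_of_tendsto hdD n)
    exact fun h => h1 (by simp [h])
  have hlim := tendsto_dyadic_inv_pow_sub r (le_self_add (a := (1 : ℝ≥0∞)))
    (ENNReal.add_ne_top.2 ⟨ENNReal.one_ne_top, hψ⟩) hD hdfin hdD
  refine tendsto_nhds_unique ?_ hlim
  have hlap : ∀ n, ((1 + ∫⁻ x, (1 - expNeg (f x)) ∂Pi + d n) ^ r)⁻¹ =
      ∫⁻ ω, expNeg (∫⁻ x, f x ∂(B ω)) * expNeg (t n * ∫⁻ x, g x ∂(B ω)) ∂P := by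
    intro n
    have h := hB.laplace (fun x => f x + t n * g x) (hf.add (hg.const_mul _))
    rw [laplaceFunctional] at h
    simp only [ENNReal.coe_add, ENNReal.coe_mul] at h
    simp only [one_sub_expNeg_add] at h
    rw [lintegral_add_left hms, ← add_assoc] at h
    rw [← h]
    refine lintegral_congr fun ω => ?_
    rw [lintegral_add_left hf.coe_nnreal_ennreal, lintegral_const_mul _ hg.coe_nnreal_ennreal,
      expNeg_add]
  have hterm : ∀ n, 2 ^ n * (((1 + ∫⁻ x, (1 - expNeg (f x)) ∂Pi) ^ r)⁻¹ -
      ((1 + ∫⁻ x, (1 - expNeg (f x)) ∂Pi + d n) ^ r)⁻¹) =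
      ∫⁻ ω, expNeg (∫⁻ x, f x ∂(B ω)) *
        (2 ^ n * (1 - expNeg (t n * ∫⁻ x, g x ∂(B ω)))) ∂P := by
    intro n
    have hm : Measurable fun ω => expNeg (∫⁻ x, f x ∂(B ω)) * expNeg (t n * ∫⁻ x, g x ∂(B ω)) :=
      hmB.mul (measurable_expNeg.comp ((hint hg).const_mul _))
    have hle : ∀ ω, expNeg (∫⁻ x, f x ∂(B ω)) * expNeg (t n * ∫⁻ x, g x ∂(B ω)) ≤ 1 := fun ω =>
      mul_le_one' (expNeg_le_one _) (expNeg_le_one _)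
    have hmd : Measurable fun ω => expNeg (∫⁻ x, f x ∂(B ω)) -
        expNeg (∫⁻ x, f x ∂(B ω)) * expNeg (t n * ∫⁻ x, g x ∂(B ω)) := hmB.sub hm
    rw [← hlf, hlap, laplaceFunctional, ← lintegral_sub hm
      (ne_top_of_le_ne_top (by simp) (lintegral_mono hle))
      (Filter.Eventually.of_forall fun ω => mul_le_of_le_one_right' (expNeg_le_one _)),
      ← lintegral_const_mul _ hmd]
    refine lintegral_congr fun ω => ?_
    rw [mul_left_comm, ENNReal.mul_sub (fun _ _ => expNeg_ne_top _), mul_one]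
  simp_rw [hterm]
  refine lintegral_tendsto_of_tendsto_of_monotone (fun n => ?_)
    (Filter.Eventually.of_forall fun x => ?_) (Filter.Eventually.of_forall fun x => ?_)
  · exact (hmB.mul ((measurable_const.sub (measurable_expNeg.comp
      ((hint hg).const_mul _))).const_mul _)).aemeasurable
  · exact fun m n hmn => mul_le_mul_right (monotone_dyadic_expNeg _ hmn) _
  · exact ENNReal.Tendsto.const_mul (tendsto_dyadic_expNeg _) (Or.inr (expNeg_ne_top _))

end Palm

/-! ### The Palm formula for negative binomial processes. -/

section Campbell

lemma measurable_add_dirac {E : Type*} [MeasurableSpace E] :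
    Measurable fun p : Measure E × E => (p.1 + Measure.dirac p.2, p.2) := by
  refine Measurable.prodMk ?_ measurable_snd
  exact measurable_fst.add (Measure.measurable_dirac.comp measurable_snd)

variable {Ω Ω' E : Type*} [MeasurableSpace Ω] [MeasurableSpace Ω'] [TopologicalSpace E]
  [MeasurableSpace E] {P : Measure Ω} {P' : Measure Ω'} {B : Ω → Measure E} {B' : Ω' → Measure E}
  {r : ℕ} {Pi : Measure E}

/-- Restricting the marked point to A with Π(A) < ∞ makes both Campbell measures finite. Their
projections to the first coordinate then agree because both have Laplace functional r ∫_A e^{-f} dΠ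
· (1 + ψ(f))^{-(r+1)}. -/
lemma IsNegBinomialProcess.campbell_rectangle [IsProbabilityMeasure P] [IsProbabilityMeasure P']
    [SigmaFinite Pi] (hB : IsNegBinomialProcess P B r Pi)
    (hB' : IsNegBinomialProcess P' B' (r + 1) Pi) (hr : r ≠ 0)
    (K : Kernel (Measure E) E) [IsSFiniteKernel K] (hK : ∀ᵐ ω ∂P, K (B ω) = B ω)
    {A : Set E} (hA : MeasurableSet A) (hPA : Pi A ≠ ∞) :
    (P.map B ⊗ₘ K) (Set.univ ×ˢ A) ≠ ∞ ∧
    ∀ S : Set (Measure E), MeasurableSet S → (P.map B ⊗ₘ K) (S ×ˢ A) =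
      (((P'.map B').prod ((r : ℝ≥0∞) • Pi)).map fun p => (p.1 + Measure.dirac p.2, p.2))
        (S ×ˢ A) := by
  have hPm : IsProbabilityMeasure (P.map B) :=
    Measure.isProbabilityMeasure_map hB.measurable.aemeasurable
  have hPm' : IsProbabilityMeasure (P'.map B') :=
    Measure.isProbabilityMeasure_map hB'.measurable.aemeasurable
  set C₁ := P.map B ⊗ₘ K with hC₁
  set C₂ := ((P'.map B').prod ((r : ℝ≥0∞) • Pi)).map fun p => (p.1 + Measure.dirac p.2, p.2)
    with hC₂
  set μ₁ := (C₁.restrict (Set.univ ×ˢ A)).map Prod.fst with hμ₁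
  set μ₂ := (C₂.restrict (Set.univ ×ˢ A)).map Prod.fst with hμ₂
  have hUA : MeasurableSet ((Set.univ : Set (Measure E)) ×ˢ A) := MeasurableSet.univ.prod hA
  have apply₁ : ∀ (C : Measure (Measure E × E)) (S : Set (Measure E)), MeasurableSet S →
      (C.restrict (Set.univ ×ˢ A)).map Prod.fst S = C (S ×ˢ A) := by
    intro C S hS
    rw [Measure.map_apply measurable_fst hS, Measure.restrict_apply (measurable_fst hS)]
    congr 1
    ext p
    simp
  have hg : Measurable (A.indicator fun _ => (1 : ℝ≥0)) := measurable_const.indicator hA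
  have hgl : ∀ M : Measure E, ∫⁻ x, ((A.indicator (fun _ => (1 : ℝ≥0)) x : ℝ≥0) : ℝ≥0∞) ∂M = M A := by
    intro M
    simp only [ENNReal.coe_indicator, ENNReal.coe_one]
    exact lintegral_indicator_one hA
  have hlap : ∀ f : E → ℝ≥0, Measurable f →
      Measurable fun M : Measure E => expNeg (∫⁻ x, f x ∂M) := fun f hf =>
    measurable_expNeg.comp (Measure.measurable_lintegral hf.coe_nnreal_ennreal)
  have hlap_fst : ∀ f : E → ℝ≥0, Measurable f →
      Measurable fun p : Measure E × E => expNeg (∫⁻ x, f x ∂p.1) := fun f hf =>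
    (hlap f hf).comp measurable_fst
  have lint₁ : ∀ f : E → ℝ≥0, Measurable f → ∫⁻ M, expNeg (∫⁻ x, f x ∂M) ∂μ₁ =
      r * (∫⁻ x in A, expNeg (f x) ∂Pi) *
        ((1 + ∫⁻ x, (1 - expNeg (f x)) ∂Pi) ^ (r + 1))⁻¹ := by
    intro f hf
    rw [hμ₁, lintegral_map (hlap f hf) measurable_fst, ← lintegral_indicator hUA, hC₁,
      Measure.lintegral_compProd ((hlap_fst f hf).indicator hUA)]
    have h1 : ∀ M : Measure E, ∫⁻ x, (Set.univ ×ˢ A).indicator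
        (fun p : Measure E × E => expNeg (∫⁻ x, f x ∂p.1)) (M, x) ∂(K M) =
        expNeg (∫⁻ x, f x ∂M) * K M A := by
      intro M
      rw [← lintegral_indicator_const hA]
      refine lintegral_congr fun x => ?_
      by_cases hx : x ∈ A <;> simp [hx]
    simp_rw [h1]
    have hm : Measurable fun M : Measure E => expNeg (∫⁻ x, f x ∂M) * K M A :=
      (hlap f hf).mul (K.measurable_coe hA)
    rw [lintegral_map hm hB.measurable]
    have h2 := hB.lintegral_expNeg_mul_lintegral hr hf hg (by rwa [hgl])
    simp only [hgl] at h2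
    have h3 : ∫⁻ x, expNeg (f x) * ((A.indicator (fun _ => (1 : ℝ≥0)) x : ℝ≥0) : ℝ≥0∞) ∂Pi =
        ∫⁻ x in A, expNeg (f x) ∂Pi := by
      rw [← lintegral_indicator hA]
      refine lintegral_congr fun x => ?_
      by_cases hx : x ∈ A <;> simp [hx]
    rw [← h3, ← h2]
    refine lintegral_congr_ae ?_
    filter_upwards [hK] with ω hω
    rw [hω]
  have lint₂ : ∀ f : E → ℝ≥0, Measurable f → ∫⁻ M, expNeg (∫⁻ x, f x ∂M) ∂μ₂ =
      r * (∫⁻ x in A, expNeg (f x) ∂Pi) *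
        ((1 + ∫⁻ x, (1 - expNeg (f x)) ∂Pi) ^ (r + 1))⁻¹ := by
    intro f hf
    rw [hμ₂, lintegral_map (hlap f hf) measurable_fst, hC₂,
      setLIntegral_map hUA (hlap_fst f hf) measurable_add_dirac]
    have h1 : (fun p : Measure E × E => (p.1 + Measure.dirac p.2, p.2)) ⁻¹' (Set.univ ×ˢ A) =
        Set.univ ×ˢ A := by
      ext p; simp
    have h2 : ∀ p : Measure E × E, expNeg (∫⁻ x, f x ∂(p.1 + Measure.dirac p.2)) =
        expNeg (∫⁻ x, f x ∂p.1) * expNeg (f p.2) := by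
      intro p
      rw [lintegral_add_measure, lintegral_dirac' _ hf.coe_nnreal_ennreal, expNeg_add]
    rw [h1, ← Measure.prod_restrict, Measure.restrict_univ]
    simp only [h2]
    rw [lintegral_prod_mul (f := fun M : Measure E => expNeg (∫⁻ x, f x ∂M))
      (g := fun x => expNeg (f x)) (hlap f hf).aemeasurable
      (measurable_expNeg.comp hf.coe_nnreal_ennreal).aemeasurable,
      lintegral_map (hlap f hf) hB'.measurable, Measure.restrict_smul, lintegral_smul_measure,
      ← hB'.laplace f hf, laplaceFunctional, smul_eq_mul, mul_comm]
  -- The total mass is the Laplace functional at f = 0.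
  have huniv : C₁ (Set.univ ×ˢ A) = r * Pi A := by
    have := lint₁ 0 measurable_zero
    simpa [expNeg_zero, hμ₁, hμ₂, apply₁ _ _ MeasurableSet.univ] using this
  have huniv₂ : C₂ (Set.univ ×ˢ A) = r * Pi A := by
    have := lint₂ 0 measurable_zero
    simpa [expNeg_zero, hμ₁, hμ₂, apply₁ _ _ MeasurableSet.univ] using this
  have hfin : r * Pi A < ∞ := ENNReal.mul_lt_top (by simp) hPA.lt_top
  refine ⟨by rw [huniv]; exact hfin.ne, fun S hS => ?_⟩
  have : IsFiniteMeasure μ₁ := ⟨by rw [hμ₁, apply₁ _ _ MeasurableSet.univ, huniv]; exact hfin⟩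
  have : IsFiniteMeasure μ₂ := ⟨by rw [hμ₂, apply₁ _ _ MeasurableSet.univ, huniv₂]; exact hfin⟩
  have hμ : μ₁ = μ₂ := Measure.ext_of_laplace fun f hf => by rw [lint₁ f hf, lint₂ f hf]
  rw [← apply₁ C₁ S hS, ← apply₁ C₂ S hS, ← hμ₁, ← hμ₂, hμ]

/-- The Palm formula: the Campbell measure of `BN(r, Π)` is the law of `(B' + δ_x, x)`, where
`x` has intensity `r Π` and `B'` is an independent `BN(r + 1, Π)`. -/
theorem IsNegBinomialProcess.campbell_eq [IsProbabilityMeasure P] [IsProbabilityMeasure P']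
    [SigmaFinite Pi] (hB : IsNegBinomialProcess P B r Pi)
    (hB' : IsNegBinomialProcess P' B' (r + 1) Pi) (hr : r ≠ 0)
    (K : Kernel (Measure E) E) [IsSFiniteKernel K] (hK : ∀ᵐ ω ∂P, K (B ω) = B ω) :
    P.map B ⊗ₘ K =
      ((P'.map B').prod ((r : ℝ≥0∞) • Pi)).map fun p => (p.1 + Measure.dirac p.2, p.2) := by
  have hrect := fun {A : Set E} (hA : MeasurableSet A) (hPA : Pi A ≠ ∞) =>
    hB.campbell_rectangle hB' hr K hK hA hPA
  refine Measure.ext_of_generateFrom_of_cover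
    (T := Set.range fun i => (Set.univ : Set (Measure E)) ×ˢ spanningSets Pi i)
    generateFrom_prod.symm (Set.countable_range _) isPiSystem_prod ?_ ?_ ?_ ?_
  · rw [Set.sUnion_range, ← Set.prod_iUnion, iUnion_spanningSets, Set.univ_prod_univ]
  · rintro _ ⟨i, rfl⟩
    exact (hrect (measurableSet_spanningSets Pi i) (measure_spanningSets_lt_top Pi i).ne).1
  · rintro _ ⟨i, rfl⟩ _ ⟨S, hS, A, hA, rfl⟩
    simp only
    rw [Set.prod_inter_prod, Set.inter_univ]
    exact (hrect (MeasurableSet.inter hA (measurableSet_spanningSets Pi i))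
      (ne_top_of_le_ne_top (measure_spanningSets_lt_top Pi i).ne
        (measure_mono Set.inter_subset_right))).2 S hS
  · rintro _ ⟨i, rfl⟩
    exact (hrect (measurableSet_spanningSets Pi i) (measure_spanningSets_lt_top Pi i).ne).2 _
      MeasurableSet.univ

end Campbell

/-! ### Size-biased picks and measurable removal of a point. -/

noncomputable section SizeBiased

lemma UnitIoo.measurable_size : Measurable UnitIoo.size :=
  measurable_subtype_coe.ennreal_ofReal

lemma UnitIoo.size_ne_zero (x : UnitIoo) : x.size ≠ 0 := by
  simpa [UnitIoo.size] using x.2.1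

lemma UnitIoo.size_ne_top (x : UnitIoo) : x.size ≠ ∞ := ENNReal.ofReal_ne_top

lemma measurable_pointSum : Measurable pointSum :=
  Measure.measurable_lintegral UnitIoo.measurable_size

lemma pointSum_add_dirac (M : Measure UnitIoo) (x : UnitIoo) :
    pointSum (M + Measure.dirac x) = pointSum M + x.size := by
  rw [pointSum, lintegral_add_measure, lintegral_dirac' _ UnitIoo.measurable_size, pointSum]

/-- The size-biased law `x / T(M) · M(dx)`, as a kernel. -/
def sizeBiasedKernel : Kernel (Measure UnitIoo) UnitIoo where
  toFun M := M.withDensity fun x => x.size / pointSum M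
  measurable' := by
    refine Measure.measurable_of_measurable_coe _ fun A hA => ?_
    have h : ∀ M : Measure UnitIoo, M.withDensity (fun x => x.size / pointSum M) A =
        (∫⁻ x, A.indicator UnitIoo.size x ∂M) * (pointSum M)⁻¹ := by
      intro M
      simp_rw [withDensity_apply _ hA, div_eq_mul_inv]
      rw [lintegral_mul_const _ UnitIoo.measurable_size, lintegral_indicator hA]
    simp_rw [h]
    exact (Measure.measurable_lintegral (UnitIoo.measurable_size.indicator hA)).mul
      measurable_pointSum.inv

lemma sizeBiasedKernel_apply (M : Measure UnitIoo) :
    sizeBiasedKernel M = M.withDensity fun x => x.size / pointSum M := rfl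

lemma sizeBiasedKernel_univ (M : Measure UnitIoo) :
    sizeBiasedKernel M Set.univ = pointSum M / pointSum M := by
  simp_rw [sizeBiasedKernel_apply, withDensity_apply _ MeasurableSet.univ, Measure.restrict_univ,
    div_eq_mul_inv]
  rw [lintegral_mul_const _ UnitIoo.measurable_size, pointSum]

instance : IsFiniteKernel sizeBiasedKernel :=
  ⟨⟨1, ENNReal.one_lt_top, fun M => by
    rw [sizeBiasedKernel_univ]; exact ENNReal.div_self_le_one⟩⟩

/-- The density of `M` with respect to its size-biased law, cut off where `T(M)` is infinite. -/
def pointKernelDensity (M : Measure UnitIoo) (x : UnitIoo) : ℝ≥0∞ :=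
  if pointSum M = ∞ then 0 else pointSum M / x.size

lemma measurable_pointKernelDensity : Measurable (Function.uncurry pointKernelDensity) :=
  Measurable.ite (measurable_pointSum.comp measurable_fst (measurableSet_singleton ∞))
    measurable_const
    ((measurable_pointSum.comp measurable_fst).div (UnitIoo.measurable_size.comp measurable_snd))

/-- An s-finite kernel that maps `M` to itself if `0 < T(M) < ∞`. -/
def pointKernel : Kernel (Measure UnitIoo) UnitIoo :=
  sizeBiasedKernel.withDensity pointKernelDensity

/-- The cut-off where T(M) = ∞ keeps the density finite, which is what makes the kernel s-finite and
the Campbell measure a composition-product. -/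
instance : IsSFiniteKernel pointKernel := by
  refine Kernel.IsSFiniteKernel.withDensity _ fun M x => ?_
  unfold pointKernelDensity
  split_ifs with h
  · simp
  · exact ENNReal.div_ne_top h x.size_ne_zero

lemma pointKernel_apply {M : Measure UnitIoo} (h0 : pointSum M ≠ 0) (hT : pointSum M ≠ ∞) :
    pointKernel M = M := by
  have hm : Measurable fun x : UnitIoo => x.size / pointSum M :=
    UnitIoo.measurable_size.div_const _
  have hd : Measurable (pointKernelDensity M) :=
    measurable_pointKernelDensity.comp measurable_prodMk_left
  rw [pointKernel, Kernel.withDensity_apply _ measurable_pointKernelDensity,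
    sizeBiasedKernel_apply, ← withDensity_mul _ hm hd]
  have h : ((fun x : UnitIoo => x.size / pointSum M) * pointKernelDensity M) = 1 := by
    funext x
    simp only [Pi.mul_apply, Pi.one_apply, pointKernelDensity, if_neg hT]
    rw [← ENNReal.inv_div (Or.inl hT) (Or.inl h0)]
    exact ENNReal.mul_inv_cancel (ENNReal.div_ne_zero.2 ⟨x.size_ne_zero, hT⟩)
      (ENNReal.div_ne_top x.size_ne_top h0)
  rw [h, withDensity_one]

/-- Remove a point from a point measure, in a jointly measurable way. -/
def removePoint (p : Measure UnitIoo × UnitIoo) : Measure UnitIoo :=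
  (pointKernel p.1).restrict {p.2}ᶜ + (pointKernel p.1 {p.2} - 1) • Measure.dirac p.2

/-- The diagonal is measurable and the kernel is s-finite, so the mass of a moving atom is jointly
measurable. -/
lemma measurable_pointKernel_singleton :
    Measurable fun p : Measure UnitIoo × UnitIoo => pointKernel p.1 {p.2} := by
  have hs : MeasurableSet {q : (Measure UnitIoo × UnitIoo) × UnitIoo | q.2 = q.1.2} :=
    measurableSet_eq_fun measurable_snd (measurable_snd.comp measurable_fst)
  exact Kernel.measurable_kernel_prodMk_left (κ := pointKernel.comap Prod.fst measurable_fst) hs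

lemma measurable_removePoint : Measurable removePoint := by
  refine Measure.measurable_of_measurable_coe _ fun A hA => ?_
  have hs : MeasurableSet {q : (Measure UnitIoo × UnitIoo) × UnitIoo | q.2 ∈ A ∧ q.2 ≠ q.1.2} :=
    (measurable_snd hA).inter
      (measurableSet_eq_fun measurable_snd (measurable_snd.comp measurable_fst)).compl
  have h1 : Measurable fun p : Measure UnitIoo × UnitIoo => pointKernel p.1 (A ∩ {p.2}ᶜ) :=
    Kernel.measurable_kernel_prodMk_left (κ := pointKernel.comap Prod.fst measurable_fst) hs
  have h : ∀ p : Measure UnitIoo × UnitIoo, removePoint p A =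
      pointKernel p.1 (A ∩ {p.2}ᶜ) + (pointKernel p.1 {p.2} - 1) * A.indicator 1 p.2 := by
    intro p
    rw [removePoint, Measure.add_apply, Measure.restrict_apply hA, Measure.smul_apply,
      Measure.dirac_apply' _ hA, smul_eq_mul]
  simp_rw [h]
  exact h1.add ((measurable_pointKernel_singleton.sub_const 1).mul
    ((measurable_one.indicator hA).comp measurable_snd))

lemma removePoint_add_dirac {p : Measure UnitIoo × UnitIoo} (h0 : pointSum p.1 ≠ 0)
    (hT : pointSum p.1 ≠ ∞) (h1 : 1 ≤ pointKernel p.1 {p.2}) :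
    removePoint p + Measure.dirac p.2 = p.1 := by
  rw [pointKernel_apply h0 hT] at h1
  rw [removePoint, pointKernel_apply h0 hT, add_assoc]
  nth_rewrite 2 [← one_smul ℝ≥0∞ (Measure.dirac p.2)]
  rw [← add_smul, tsub_add_cancel_of_le h1, ← Measure.restrict_singleton, add_comm,
    Measure.restrict_add_restrict_compl (measurableSet_singleton _)]

/-- An atom of mass at least 1 at x makes truncated subtraction of measures a genuine removal, and
so identifies it with a jointly measurable map. -/
lemma sub_dirac_eq_removePoint {M : Measure UnitIoo} {x : UnitIoo} (h0 : pointSum M ≠ 0)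
    (hT : pointSum M ≠ ∞) (h1 : 1 ≤ pointKernel M {x}) :
    M - Measure.dirac x = removePoint (M, x) := by
  have h : removePoint (M, x) + Measure.dirac x = M := removePoint_add_dirac (p := (M, x)) h0 hT h1
  conv_lhs => rw [← h]
  exact Measure.add_sub_cancel

lemma pointSum_add_dirac_ne_zero (M : Measure UnitIoo) (x : UnitIoo) :
    pointSum (M + Measure.dirac x) ≠ 0 := by
  rw [pointSum_add_dirac]
  simp [x.size_ne_zero]

lemma pointSum_add_dirac_ne_top {M : Measure UnitIoo} (hM : pointSum M ≠ ∞) (x : UnitIoo) :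
    pointSum (M + Measure.dirac x) ≠ ∞ := by
  rw [pointSum_add_dirac]
  exact ENNReal.add_ne_top.2 ⟨hM, x.size_ne_top⟩

lemma one_le_pointKernel_add_dirac {M : Measure UnitIoo} (hM : pointSum M ≠ ∞) (x : UnitIoo) :
    1 ≤ pointKernel (M + Measure.dirac x) {x} := by
  rw [pointKernel_apply (pointSum_add_dirac_ne_zero M x) (pointSum_add_dirac_ne_top hM x)]
  simp

lemma removePoint_of_add_dirac {M : Measure UnitIoo} (hM : pointSum M ≠ ∞) (x : UnitIoo) :
    removePoint (M + Measure.dirac x, x) = M := by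
  rw [← sub_dirac_eq_removePoint (pointSum_add_dirac_ne_zero M x) (pointSum_add_dirac_ne_top hM x)
    (one_le_pointKernel_add_dirac hM x), Measure.add_sub_cancel]

variable {Ω : Type*} [MeasurableSpace Ω] {P : Measure Ω}
  {B : Ω → Measure UnitIoo} {J : Ω → UnitIoo}

lemma IsSizeBiasedPick.condProb_eq (hJ : IsSizeBiasedPick P B J) {A : Set UnitIoo}
    (hA : MeasurableSet A) :
    P⟦J ⁻¹' A | MeasurableSpace.comap B inferInstance⟧ =ᵐ[P]
      fun ω => (sizeBiasedKernel (B ω) A).toReal := by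
  filter_upwards [hJ.condProb A hA] with ω hω
  rw [hω, sizeBiasedKernel_apply, withDensity_apply _ hA]

variable [IsProbabilityMeasure P]

/-- A random measure that admits a size-biased pick has a positive and finite sum. -/
lemma IsSizeBiasedPick.pointSum_ne (hJ : IsSizeBiasedPick P B J) (hB : Measurable B) :
    ∀ᵐ ω ∂P, pointSum (B ω) ≠ 0 ∧ pointSum (B ω) ≠ ∞ := by
  have h := hJ.condProb_eq MeasurableSet.univ
  rw [Set.preimage_univ, Set.indicator_univ, condExp_const hB.comap_le] at h
  filter_upwards [h] with ω hω
  rw [sizeBiasedKernel_univ] at hω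
  -- The conditional law has mass 1, while T / T = 0 in `ℝ≥0∞` when T is 0 or ∞.
  constructor <;> intro h0 <;> simp [h0] at hω

/-- The joint law of a random measure and its size-biased pick. -/
lemma IsSizeBiasedPick.map_prodMk (hJ : IsSizeBiasedPick P B J) (hB : Measurable B) :
    P.map (fun ω => (B ω, J ω)) = P.map B ⊗ₘ sizeBiasedKernel := by
  have hPB : IsProbabilityMeasure (P.map B) := Measure.isProbabilityMeasure_map hB.aemeasurable
  have hBJ : Measurable fun ω => (B ω, J ω) := hB.prodMk hJ.measurable
  have : IsProbabilityMeasure (P.map fun ω => (B ω, J ω)) :=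
    Measure.isProbabilityMeasure_map hBJ.aemeasurable
  refine Measure.ext_prod fun {S A} hS hA => ?_
  rw [Measure.compProd_apply_prod hS hA, Measure.map_apply hBJ (hS.prod hA),
    setLIntegral_map hS (sizeBiasedKernel.measurable_coe hA) hB]
  have hpre : (fun ω => (B ω, J ω)) ⁻¹' S ×ˢ A = J ⁻¹' A ∩ B ⁻¹' S := by
    ext ω; simp [and_comm]
  have hint : Integrable ((J ⁻¹' A).indicator fun _ => (1 : ℝ)) P :=
    (integrable_const 1).indicator (hJ.measurable hA)
  -- The defining property of conditional probability on the event B ∈ S is the rectangle identity,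
  -- up to `toReal`.
  have h := setIntegral_condExp hB.comap_le hint ⟨S, hS, rfl⟩
  have hle : ∀ ω, sizeBiasedKernel (B ω) A ≤ 1 := fun ω =>
    (measure_mono (Set.subset_univ A)).trans
      ((sizeBiasedKernel_univ _).le.trans ENNReal.div_self_le_one)
  have hmA : Measurable fun ω => sizeBiasedKernel (B ω) A :=
    (sizeBiasedKernel.measurable_coe hA).comp hB
  rw [setIntegral_congr_ae (g := fun ω => (sizeBiasedKernel (B ω) A).toReal) (hB hS)
    ((hJ.condProb_eq hA).mono fun ω hω _ => hω), integral_indicator_const _ (hJ.measurable hA),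
    integral_toReal hmA.aemeasurable
    (Filter.Eventually.of_forall fun ω => (hle ω).trans_lt ENNReal.one_lt_top)] at h
  rw [hpre, ← Measure.restrict_apply (hJ.measurable hA), ← ENNReal.toReal_eq_toReal_iff']
  · rw [h]; simp [Measure.real]
  · exact measure_ne_top _ _
  · refine ne_top_of_le_ne_top ENNReal.one_ne_top ((lintegral_mono hle).trans ?_)
    simpa using prob_le_one

end SizeBiased

/-! ### The measure α x^{-α-1} dx is σ-finite with infinite mass. -/

section StableLevy

instance (α : ℝ) : SigmaFinite (stableLevy α) := by
  have : IsFiniteMeasure (Measure.comap ((↑) : UnitIoo → ℝ) volume) := by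
    refine ⟨?_⟩
    have h := lintegral_subtype_comap (μ := (volume : Measure ℝ)) (measurableSet_Ioo (a := 0) (b := 1))
      (fun _ => 1)
    simp only [lintegral_const, one_mul, Measure.restrict_apply_univ] at h
    rw [h]
    simp
  exact SigmaFinite.withDensity_of_ne_top (Filter.Eventually.of_forall fun _ => ENNReal.ofReal_ne_top)

lemma stableLevy_univ {α : ℝ} (hα : 0 < α) : stableLevy α Set.univ = ∞ := by
  rw [stableLevy, withDensity_apply _ MeasurableSet.univ, Measure.restrict_univ,
    lintegral_subtype_comap measurableSet_Ioo
      (fun x : ℝ => ENNReal.ofReal (α * x ^ (-α - 1)))]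
  by_contra h
  have hint : IntegrableOn (fun x : ℝ => α * x ^ (-α - 1)) (Set.Ioo 0 1) := by
    refine ⟨by fun_prop, ?_⟩
    rw [hasFiniteIntegral_iff_ofReal]
    · exact lt_top_iff_ne_top.2 h
    · filter_upwards [ae_restrict_mem measurableSet_Ioo] with x hx
      have := Real.rpow_nonneg hx.1.le (-α - 1)
      simp only [Pi.zero_apply]
      positivity
  have hint' : IntegrableOn (fun x : ℝ => x ^ (-α - 1)) (Set.Ioo 0 1) := by
    have : Integrable (fun x : ℝ => x ^ (-α - 1)) (volume.restrict (Set.Ioo 0 1)) := by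
      simpa [← mul_assoc, inv_mul_cancel₀ hα.ne'] using Integrable.const_mul hint α⁻¹
    exact this
  -- Integrability at 0 would require -α - 1 > -1.
  rw [intervalIntegral.integrableOn_Ioo_rpow_iff one_pos] at hint'
  linarith

end StableLevy

/-! ### The joint law of the pick, the remaining process and the remaining sum. -/

section Removal

variable {Ω Ω' : Type*} [MeasurableSpace Ω] [MeasurableSpace Ω'] {P : Measure Ω} {P' : Measure Ω'}
  {B : Ω → Measure UnitIoo} {B' : Ω' → Measure UnitIoo} {J : Ω → UnitIoo}
  {r : ℕ} {Λ : Measure UnitIoo}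

/-- A negative binomial process with infinite base measure has infinitely many points. -/
lemma IsNegBinomialProcess.pointSum_ne_zero (hB : IsNegBinomialProcess P B r Λ) (hr : r ≠ 0)
    (hΛ : Λ Set.univ = ∞) : ∀ᵐ ω ∂P, pointSum (B ω) ≠ 0 := by
  -- At f = 1, ψ(f) = ∞, so e^{-B(0,1)} = 0 almost surely; T(B) = 0 would force B(0,1) = 0, as every
  -- point has positive size.
  have h := hB.laplace (fun _ => 1) measurable_const
  have h1 : 1 - expNeg ((1 : ℝ≥0) : ℝ≥0∞) ≠ 0 := by
    rw [expNeg_coe]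
    simp [tsub_eq_zero_iff_le, ENNReal.one_le_ofReal]
  simp only [laplaceFunctional, lintegral_const, hΛ, ENNReal.mul_top h1, add_top,
    ENNReal.top_pow hr, ENNReal.inv_top] at h
  have hm : Measurable fun ω => expNeg (((1 : ℝ≥0) : ℝ≥0∞) * B ω Set.univ) :=
    measurable_expNeg.comp
      (((Measure.measurable_coe MeasurableSet.univ).comp hB.measurable).const_mul _)
  rw [lintegral_eq_zero_iff hm] at h
  filter_upwards [h] with ω hω h0
  rw [pointSum, lintegral_eq_zero_iff UnitIoo.measurable_size] at h0
  have hzero : B ω Set.univ = 0 := by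
    rw [← nonpos_iff_eq_zero, ← show B ω {x | ¬ x.size = 0} = 0 from h0]
    exact measure_mono fun x _ => x.size_ne_zero
  simp [hzero, expNeg_zero] at hω

variable [IsProbabilityMeasure P] [IsProbabilityMeasure P'] [SigmaFinite Λ]

/-- The joint law of a negative binomial process and its size-biased pick. -/
theorem IsNegBinomialProcess.lintegral_sizeBiasedPick (hB : IsNegBinomialProcess P B r Λ)
    (hB' : IsNegBinomialProcess P' B' (r + 1) Λ) (hr : r ≠ 0) (hJ : IsSizeBiasedPick P B J)
    {F : Measure UnitIoo × UnitIoo → ℝ≥0∞} (hF : Measurable F) :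
    ∫⁻ ω, F (B ω, J ω) ∂P =
      ∫⁻ p, F (p.1 + Measure.dirac p.2, p.2) * (p.2.size / (pointSum p.1 + p.2.size))
        ∂((P'.map B').prod ((r : ℝ≥0∞) • Λ)) := by
  have hPB : IsProbabilityMeasure (P.map B) :=
    Measure.isProbabilityMeasure_map hB.measurable.aemeasurable
  have hT := hJ.pointSum_ne hB.measurable
  have hK : ∀ᵐ ω ∂P, pointKernel (B ω) = B ω := by
    filter_upwards [hT] with ω hω using pointKernel_apply hω.1 hω.2
  have hG : Measurable fun p : Measure UnitIoo × UnitIoo =>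
      F p * (p.2.size / pointSum p.1) :=
    hF.mul ((UnitIoo.measurable_size.comp measurable_snd).div
      (measurable_pointSum.comp measurable_fst))
  have h1 : ∫⁻ ω, F (B ω, J ω) ∂P = ∫⁻ ω, ∫⁻ x, F (B ω, x) ∂(sizeBiasedKernel (B ω)) ∂P := by
    rw [← lintegral_map hF (hB.measurable.prodMk hJ.measurable), hJ.map_prodMk hB.measurable,
      Measure.lintegral_compProd hF, lintegral_map hF.lintegral_kernel_prod_right' hB.measurable]
  have h2 : ∫⁻ p, F p * (p.2.size / pointSum p.1) ∂(P.map B ⊗ₘ pointKernel) =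
      ∫⁻ ω, ∫⁻ x, F (B ω, x) * (x.size / pointSum (B ω)) ∂(pointKernel (B ω)) ∂P := by
    rw [Measure.lintegral_compProd hG, lintegral_map hG.lintegral_kernel_prod_right' hB.measurable]
  -- The law of (B, J) is the Campbell measure weighted by x / T(M).
  have h3 : ∫⁻ ω, F (B ω, J ω) ∂P =
      ∫⁻ p, F p * (p.2.size / pointSum p.1) ∂(P.map B ⊗ₘ pointKernel) := by
    rw [h1, h2]
    refine lintegral_congr_ae ?_
    filter_upwards [hK] with ω hω
    have hFω : Measurable fun x => F (B ω, x) := hF.comp measurable_prodMk_left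
    rw [hω, sizeBiasedKernel_apply, lintegral_withDensity_eq_lintegral_mul _
      (UnitIoo.measurable_size.div_const _) hFω]
    exact lintegral_congr fun x => mul_comm _ _
  rw [h3, hB.campbell_eq hB' hr pointKernel hK, lintegral_map hG measurable_add_dirac]
  simp only [pointSum_add_dirac]

lemma IsNegBinomialProcess.sub_dirac_ae_eq (hB : IsNegBinomialProcess P B r Λ)
    (hB' : IsNegBinomialProcess P' B' (r + 1) Λ) (hr : r ≠ 0) (hJ : IsSizeBiasedPick P B J) :
    ∀ᵐ ω ∂P, B ω - Measure.dirac (J ω) = removePoint (B ω, J ω) := by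
  have hs : MeasurableSet {p : Measure UnitIoo × UnitIoo | pointKernel p.1 {p.2} < 1} :=
    measurableSet_lt measurable_pointKernel_singleton measurable_const
  have hF : Measurable ({p : Measure UnitIoo × UnitIoo | pointKernel p.1 {p.2} < 1}.indicator
      fun _ => (1 : ℝ≥0∞)) := measurable_const.indicator hs
  have h : ∫⁻ ω, {p : Measure UnitIoo × UnitIoo | pointKernel p.1 {p.2} < 1}.indicator
      (fun _ => (1 : ℝ≥0∞)) (B ω, J ω) ∂P = 0 := by
    rw [hB.lintegral_sizeBiasedPick hB' hr hJ hF]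
    refine (lintegral_congr fun p => ?_).trans lintegral_zero
    -- Where T(M) = ∞ the weight x / (T(M) + x) is 0; elsewhere M + δ_x has an atom of mass at least
    -- 1 at x.
    by_cases hp : pointSum p.1 = ∞
    · simp [hp]
    · simp [one_le_pointKernel_add_dirac hp p.2]
  have hFBJ : Measurable fun ω => {p : Measure UnitIoo × UnitIoo |
      pointKernel p.1 {p.2} < 1}.indicator (fun _ => (1 : ℝ≥0∞)) (B ω, J ω) :=
    hF.comp (hB.measurable.prodMk hJ.measurable)
  rw [lintegral_eq_zero_iff hFBJ] at h
  filter_upwards [h, hJ.pointSum_ne hB.measurable] with ω hω hT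
  refine sub_dirac_eq_removePoint hT.1 hT.2 ?_
  simpa using hω

/-- The joint law of the size-biased pick, the remaining process and the remaining sum. -/
theorem IsNegBinomialProcess.lintegral_removal (hB : IsNegBinomialProcess P B r Λ)
    (hB' : IsNegBinomialProcess P' B' (r + 1) Λ) (hr : r ≠ 0) (hJ : IsSizeBiasedPick P B J)
    {h : UnitIoo × Measure UnitIoo × ℝ≥0∞ → ℝ≥0∞} (hh : Measurable h) :
    ∫⁻ ω, h (J ω, B ω - Measure.dirac (J ω), pointSum (B ω) - (J ω).size) ∂P =
      ∫⁻ p, h (p.1, p.2, pointSum p.2) * (p.1.size / (pointSum p.2 + p.1.size))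
        ∂(((r : ℝ≥0∞) • Λ).prod (P'.map B')) := by
  have hPB' : IsProbabilityMeasure (P'.map B') :=
    Measure.isProbabilityMeasure_map hB'.measurable.aemeasurable
  have hF : Measurable fun p : Measure UnitIoo × UnitIoo =>
      h (p.2, removePoint p, pointSum p.1 - p.2.size) :=
    hh.comp (measurable_snd.prodMk (measurable_removePoint.prodMk
      ((measurable_pointSum.comp measurable_fst).sub
        (UnitIoo.measurable_size.comp measurable_snd))))
  have h1 : ∫⁻ ω, h (J ω, B ω - Measure.dirac (J ω), pointSum (B ω) - (J ω).size) ∂P =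
      ∫⁻ ω, h (J ω, removePoint (B ω, J ω), pointSum (B ω) - (J ω).size) ∂P := by
    refine lintegral_congr_ae ?_
    filter_upwards [hB.sub_dirac_ae_eq hB' hr hJ] with ω hω
    rw [hω]
  rw [h1, hB.lintegral_sizeBiasedPick hB' hr hJ hF]
  have h2 : ∀ p : Measure UnitIoo × UnitIoo,
      h (p.2, removePoint (p.1 + Measure.dirac p.2, p.2),
        pointSum (p.1 + Measure.dirac p.2) - p.2.size) *
        (p.2.size / (pointSum p.1 + p.2.size)) =
      (fun q : UnitIoo × Measure UnitIoo =>
        h (q.1, q.2, pointSum q.2) * (q.1.size / (pointSum q.2 + q.1.size))) p.swap := by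
    intro p
    -- The weight again vanishes where T(M) = ∞, so finiteness of T(B') is never needed.
    by_cases hp : pointSum p.1 = ∞
    · simp [hp]
    · simp only [Prod.fst_swap, Prod.snd_swap]
      rw [removePoint_of_add_dirac hp, pointSum_add_dirac,
        ENNReal.add_sub_cancel_right p.2.size_ne_top]
  simp only [h2]
  exact lintegral_prod_swap (μ := (r : ℝ≥0∞) • Λ) (ν := P'.map B')
    (fun q : UnitIoo × Measure UnitIoo =>
      h (q.1, q.2, pointSum q.2) * (q.1.size / (pointSum q.2 + q.1.size)))

variable {Z : Type*} [MeasurableSpace Z]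

/-- The law of a function of the size-biased pick, the remaining process and the remaining sum. -/
theorem IsNegBinomialProcess.map_removal (hB : IsNegBinomialProcess P B r Λ)
    (hB' : IsNegBinomialProcess P' B' (r + 1) Λ) (hr : r ≠ 0) (hJ : IsSizeBiasedPick P B J)
    {ψ : UnitIoo × Measure UnitIoo × ℝ≥0∞ → Z} (hψ : Measurable ψ)
    {d : Z → ℝ≥0∞} (hd : Measurable d)
    (hdψ : ∀ x M, d (ψ (x, M, pointSum M)) = x.size / (pointSum M + x.size)) :
    AEMeasurable (fun ω =>
      ψ (J ω, B ω - Measure.dirac (J ω), pointSum (B ω) - (J ω).size)) P ∧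
    P.map (fun ω => ψ (J ω, B ω - Measure.dirac (J ω), pointSum (B ω) - (J ω).size)) =
      ((((r : ℝ≥0∞) • Λ).prod (P'.map B')).map fun p =>
        ψ (p.1, p.2, pointSum p.2)).withDensity d := by
  have hBJ : Measurable fun ω => (B ω, J ω) := hB.measurable.prodMk hJ.measurable
  have hae : AEMeasurable (fun ω =>
      ψ (J ω, B ω - Measure.dirac (J ω), pointSum (B ω) - (J ω).size)) P := by
    refine ⟨fun ω => ψ (J ω, removePoint (B ω, J ω), pointSum (B ω) - (J ω).size), ?_, ?_⟩
    · exact hψ.comp (hJ.measurable.prodMk ((measurable_removePoint.comp hBJ).prodMk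
        ((measurable_pointSum.comp hB.measurable).sub
          (UnitIoo.measurable_size.comp hJ.measurable))))
    · filter_upwards [hB.sub_dirac_ae_eq hB' hr hJ] with ω hω
      rw [hω]
  refine ⟨hae, Measure.ext fun S hS => ?_⟩
  have hΦ : Measurable fun p : UnitIoo × Measure UnitIoo => ψ (p.1, p.2, pointSum p.2) :=
    hψ.comp (measurable_fst.prodMk (measurable_snd.prodMk
      (measurable_pointSum.comp measurable_snd)))
  have hind : Measurable fun q => S.indicator (fun _ => (1 : ℝ≥0∞)) (ψ q) :=
    (measurable_const.indicator hS).comp hψ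
  rw [← lintegral_indicator_one hS, lintegral_map' (measurable_one.indicator hS).aemeasurable hae,
    withDensity_apply _ hS, ← lintegral_indicator hS, lintegral_map (hd.indicator hS) hΦ]
  refine (hB.lintegral_removal hB' hr hJ hind).trans (lintegral_congr fun p => ?_)
  by_cases hp : ψ (p.1, p.2, pointSum p.2) ∈ S <;> simp [hp, hdψ]

/-- The remaining sum is almost surely positive and finite. -/
lemma IsNegBinomialProcess.remaining_sum_mem_Ioo (hB : IsNegBinomialProcess P B r Λ)
    (hB' : IsNegBinomialProcess P' B' (r + 1) Λ) (hr : r ≠ 0) (hJ : IsSizeBiasedPick P B J)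
    (hΛ : Λ Set.univ = ∞) :
    ∀ᵐ ω ∂P, 0 < pointSum (B ω) - (J ω).size ∧ pointSum (B ω) - (J ω).size < ∞ := by
  have hPB' : IsProbabilityMeasure (P'.map B') :=
    Measure.isProbabilityMeasure_map hB'.measurable.aemeasurable
  have hs : MeasurableSet ({0} : Set ℝ≥0∞) := measurableSet_singleton 0
  have hind : Measurable fun q : UnitIoo × Measure UnitIoo × ℝ≥0∞ =>
      ({0} : Set ℝ≥0∞).indicator (fun _ => (1 : ℝ≥0∞)) q.2.2 :=
    (measurable_const.indicator hs).comp (measurable_snd.comp measurable_snd)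
  have hm : Measurable fun ω => ({0} : Set ℝ≥0∞).indicator (fun _ => (1 : ℝ≥0∞))
      (pointSum (B ω) - (J ω).size) :=
    (measurable_const.indicator hs).comp
      ((measurable_pointSum.comp hB.measurable).sub (UnitIoo.measurable_size.comp hJ.measurable))
  have hsT : MeasurableSet {M : Measure UnitIoo | pointSum M ≠ 0} :=
    (measurable_pointSum hs).compl
  have hz : ∀ᵐ M ∂(P'.map B'), pointSum M ≠ 0 := by
    rw [ae_map_iff hB'.measurable.aemeasurable hsT]
    exact hB'.pointSum_ne_zero (Nat.succ_ne_zero r) hΛ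
  -- The remaining sum is distributed as T(B') under a weighted product measure, and T(B') ≠ 0
  -- almost surely.
  have h : ∫⁻ ω, ({0} : Set ℝ≥0∞).indicator (fun _ => (1 : ℝ≥0∞))
      (pointSum (B ω) - (J ω).size) ∂P = 0 := by
    refine (hB.lintegral_removal hB' hr hJ hind).trans
      ((lintegral_congr_ae ?_).trans lintegral_zero)
    filter_upwards [Measure.quasiMeasurePreserving_snd.ae hz] with p hp
    simp [hp]
  rw [lintegral_eq_zero_iff hm] at h
  filter_upwards [h, hJ.pointSum_ne hB.measurable] with ω hω hT
  refine ⟨pos_iff_ne_zero.2 fun h0 => ?_, tsub_le_self.trans_lt hT.2.lt_top⟩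
  simp [h0] at hω

end Removal
theorem proposition2p4 (α : ℝ) (hα0 : 0 < α) (hα1 : α < 1) (r : ℕ) (hr : 1 ≤ r)
    {Ω : Type*} [MeasurableSpace Ω] (P : Measure Ω) [IsProbabilityMeasure P]
    {Ω' : Type*} [MeasurableSpace Ω'] (P' : Measure Ω') [IsProbabilityMeasure P']
    -- `B` is the process `𝔹^{(r)}`, `B'` a process `𝔹^{(r+1)}`, `J` the first size-biased pick
    (B : Ω → Measure UnitIoo) (hB : IsNegBinomialProcess P B r (stableLevy α))
    (B' : Ω' → Measure UnitIoo) (hB' : IsNegBinomialProcess P' B' (r + 1) (stableLevy α))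
    (J : Ω → UnitIoo) (hJ : IsSizeBiasedPick P B J)
    -- the remaining process and the remaining sum
    (B₁ : Ω → Measure UnitIoo) (hB₁ : ∀ ω, B₁ ω = B ω - Measure.dirac (J ω))
    (T₁ : Ω → ℝ≥0∞) (hT₁ : ∀ ω, T₁ ω = pointSum (B ω) - (J ω).size) :
    -- (i)
    (AEMeasurable (fun ω => (J ω, B₁ ω)) P ∧
      P.map (fun ω => (J ω, B₁ ω)) =
        (((r : ℝ≥0∞) • stableLevy α).prod (P'.map B')).withDensity
          (fun p => p.1.size / (pointSum p.2 + p.1.size))) ∧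
    -- (ii)
    (AEMeasurable (fun ω => (J ω, B₁ ω, T₁ ω)) P ∧
      P.map (fun ω => (J ω, B₁ ω, T₁ ω)) =
        (((r : ℝ≥0∞) • stableLevy α).prod
            (P'.map (fun ω' => (B' ω', pointSum (B' ω'))))).withDensity
          (fun p => p.1.size / (p.2.2 + p.1.size))) ∧
    -- (iii)
    (AEMeasurable (fun ω => (J ω, T₁ ω)) P ∧
      P.map (fun ω => (J ω, T₁ ω)) =
        (((r : ℝ≥0∞) • stableLevy α).prod (P'.map (fun ω' => pointSum (B' ω')))).withDensity
          (fun p => p.1.size / (p.2 + p.1.size)) ∧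
      ∀ᵐ ω ∂P, 0 < T₁ ω ∧ T₁ ω < ∞) := by
  have hr0 : r ≠ 0 := Nat.one_le_iff_ne_zero.1 hr
  obtain rfl : B₁ = fun ω => B ω - Measure.dirac (J ω) := funext hB₁
  obtain rfl : T₁ = fun ω => pointSum (B ω) - (J ω).size := funext hT₁
  have hPB' : IsProbabilityMeasure (P'.map B') :=
    Measure.isProbabilityMeasure_map hB'.measurable.aemeasurable
  have hsize : Measurable fun p : UnitIoo × ℝ≥0∞ => p.1.size / (p.2 + p.1.size) :=
    (UnitIoo.measurable_size.comp measurable_fst).div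
      (measurable_snd.add (UnitIoo.measurable_size.comp measurable_fst))
  have hpair : Measurable fun M : Measure UnitIoo => (M, pointSum M) :=
    measurable_id.prodMk measurable_pointSum
  refine ⟨?_, ?_, ?_, ?_, hB.remaining_sum_mem_Ioo hB' hr0 hJ (stableLevy_univ hα0)⟩
  · have h := hB.map_removal hB' hr0 hJ (ψ := fun q => (q.1, q.2.1))
      (measurable_fst.prodMk measurable_snd.fst)
      (hsize.comp (measurable_fst.prodMk (measurable_pointSum.comp measurable_snd)))
      fun _ _ => rfl
    refine ⟨h.1, h.2.trans ?_⟩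
    rw [show (fun p : UnitIoo × Measure UnitIoo => (p.1, p.2)) = id from rfl, Measure.map_id]
    rfl
  · have h := hB.map_removal hB' hr0 hJ (ψ := id) measurable_id
      (hsize.comp (measurable_fst.prodMk measurable_snd.snd)) fun _ _ => rfl
    refine ⟨h.1, h.2.trans ?_⟩
    -- The map acts on the second factor alone, so the image of the product is again a product.
    have hprod := Measure.map_prod_map ((r : ℝ≥0∞) • stableLevy α) (P'.map B') measurable_id hpair
    rw [Measure.map_id, Measure.map_map hpair hB'.measurable] at hprod
    exact congrArg (fun ρ => Measure.withDensity ρ _) hprod.symm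
  · have h := hB.map_removal hB' hr0 hJ (ψ := fun q => (q.1, q.2.2))
      (measurable_fst.prodMk measurable_snd.snd) hsize fun _ _ => rfl
    exact h.1
  · have h := hB.map_removal hB' hr0 hJ (ψ := fun q => (q.1, q.2.2))
      (measurable_fst.prodMk measurable_snd.snd) hsize fun _ _ => rfl
    refine h.2.trans ?_
    have hprod := Measure.map_prod_map ((r : ℝ≥0∞) • stableLevy α) (P'.map B') measurable_id
      measurable_pointSum
    rw [Measure.map_id, Measure.map_map measurable_pointSum hB'.measurable] at hprod
    exact congrArg (fun ρ => Measure.withDensity ρ _) hprod.symm
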